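/- Let $p\ge 3$ be a prime, $h\ge2$ an integer, $q=p^{2h}$, let $R\ge2$ be even, let $t\ge1$ be an integer and $r=tR+\frac R2$. An $[n,n-r]_qR$ code is a linear code of length $n$ and dimension $n-r$ over $\mathbb F_q$ whose covering radius is $R$, i.e. $R$ is the least integer such that the Hamming balls of radius $R$ centered at the codewords cover $\mathbb F_q^{\,n}$. The length function $\ell_q(r,R)$ is the smallest $n$ for which an $[n,n-r]_qR$ code exists. Let $\phi=\phi(\sqrt q)$ be the order of the largest proper subfield of $\mathbb F_{\sqrt q}$, and put $f_q(r,R)=q^{(r-3R)/R-1/2}+q^{(r-4R)/R-1/2}$ if $r=\frac{9R}{2}$ or $r=\frac{13R}{2}$, and $f_q(r,R)=0$ otherwise. Define $$A=R\left(1+\frac{\sqrt q-1}{\sqrt q\,(\phi(\sqrt q)-1)}\right)q^{(r-R)/R}+R\left\lfloor q^{(r-2R)/R-1/2}\right\rfloor+\frac R2 f_q(r,R),$$ $$B=R\left(1+\frac1p+\frac1{\sqrt q}\right)q^{(r-R)/R}+R\left\lfloor q^{(r-2R)/R-1/2}\right\rfloor+\frac R2 f_q(r,R).$$ (i) There is an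 $[n,n-r]_qR$ code of length exactly $n=A$; in particular $\ell_q(r,R)\le A$. (ii) If $p\ge7$, there is an $[n,n-r]_qR$ code of length exactly $n=B$; in particular $\ell_q(r,R)\le B$. (Thus, for fixed $p,h,R$, letting $t$ run through $1,2,3,\dots$ gives infinite families of codes of fixed covering radius $R$.) (iii) Comparison with the previously known bounds. Let $$K_2=\frac R2\left(3-\frac1{\sqrt q}\right)q^{(r-R)/R}+\frac R2\left\lfloor q^{(r-2R)/R-1/2}\right\rfloor$$ be the known upper bound on $\ell_q(r,R)$ for square $q$, and $$K_6=R\left(1+\frac1{\sqrt[6]q}+\frac1{\sqrt[3]q}+\frac1{\sqrt q}\right)q^{(r-R)/R}+R\left\lfloor q^{(r-2R)/R-1/2}\right\rfloor$$ the known upper bound for $q=p^6$, $p\le73$, $t\ne4,6$. If $h\ge3$ is odd, then $A<K_2$ provided $\phi(\sqrt q)\ne3$, and $B<K_2$ provided $p\ge7$. If $h=3$, $p\ge7$ and $t\ne4,6$, then $B=K_6-R\,q^{(r-R)/R-1/3}$. -/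

import Mathlib

namespace CoveringCode

open Classical in
/-- The space `Fⁿ` is covered by the Hamming balls of radius `ρ` centered at the codewords. -/
def CoveredByBalls {F : Type*} [Field F] {n : ℕ} (C : Submodule F (Fin n → F)) (ρ : ℕ) : Prop :=
  ∀ v : Fin n → F, ∃ c ∈ C, hammingDist v c ≤ ρ

/-- `C` has covering radius (exactly) `R`: the least radius whose balls cover the space. -/
def HasCoveringRadius {F : Type*} [Field F] {n : ℕ} (C : Submodule F (Fin n → F)) (R : ℕ) : Prop :=
  IsLeast {ρ : ℕ | CoveredByBalls C ρ} R

/-- There is an `[n, n - r]_q R` code over the field `F` of order `q`: a linear code of length `n`,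
codimension `r` and covering radius `R`. -/
def ExistsCode (F : Type*) [Field F] (n r R : ℕ) : Prop :=
  ∃ C : Submodule F (Fin n → F), Module.finrank F C + r = n ∧ HasCoveringRadius C R

/-- The length function `ℓ_q(r, R)`, `F` being the field of order `q`. -/
noncomputable def lengthFunction (F : Type*) [Field F] (r R : ℕ) : ℕ :=
  sInf {n : ℕ | ExistsCode F n r R}

/-- The order of the largest proper subfield of a finite field `E`. -/
noncomputable def largestProperSubfieldOrder (E : Type*) [Field E] : ℕ :=
  sSup {m : ℕ | ∃ K : Subfield E, K ≠ ⊤ ∧ Nat.card K = m}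

/-- `f_q(r, R)`, which vanishes unless `r = 9R/2` or `r = 13R/2`. -/
noncomputable def fTerm (q r R : ℕ) : ℝ :=
  if 2 * r = 9 * R ∨ 2 * r = 13 * R then
    (q : ℝ) ^ (((r : ℝ) - 3 * R) / R - 1 / 2) + (q : ℝ) ^ (((r : ℝ) - 4 * R) / R - 1 / 2)
  else 0

/-- The integer `⌊q ^ ((r - 2R)/R - 1 / 2)⌋`, as a real number. -/
noncomputable def floorTerm (q r R : ℕ) : ℝ :=
  (⌊(q : ℝ) ^ (((r : ℝ) - 2 * R) / R - 1 / 2)⌋ : ℝ)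

/-- The new length expressed through `φ`, the order of the largest proper subfield of the field
of order `√q`. -/
noncomputable def subfieldLength (q φ r R : ℕ) : ℝ :=
  R * (1 + (√(q : ℝ) - 1) / (√(q : ℝ) * ((φ : ℝ) - 1))) * (q : ℝ) ^ (((r : ℝ) - R) / R)
    + R * floorTerm q r R + R / 2 * fTerm q r R

/-- The new length expressed through the characteristic `p`. -/
noncomputable def charLength (q p r R : ℕ) : ℝ :=
  R * (1 + 1 / (p : ℝ) + 1 / √(q : ℝ)) * (q : ℝ) ^ (((r : ℝ) - R) / R)
    + R * floorTerm q r R + R / 2 * fTerm q r R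

/-- The previously known upper bound on the length function for square `q`. -/
noncomputable def knownSquareBound (q r R : ℕ) : ℝ :=
  R / 2 * (3 - 1 / √(q : ℝ)) * (q : ℝ) ^ (((r : ℝ) - R) / R) + R / 2 * floorTerm q r R

/-- The previously known upper bound on the length function for `q` a sixth power. -/
noncomputable def knownSixthBound (q r R : ℕ) : ℝ :=
  R * (1 + 1 / (q : ℝ) ^ (1 / 6 : ℝ) + 1 / (q : ℝ) ^ (1 / 3 : ℝ) + 1 / √(q : ℝ))
      * (q : ℝ) ^ (((r : ℝ) - R) / R)
    + R * floorTerm q r R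

end CoveringCode

/-!
Let `Q = √q` and let `k` be a proper subfield of the field `K` of order `Q`, with `|k| ≥ 3`. All the
codes come from one construction, which gives the first length with `k` of order `φ` and the second
one with `k` the prime field. Only the case `R = 2` is at stake: covering radii add up in direct
sums (`ExistsCode.add`), so `R / 2` copies of a code of radius two give the general case, and a code
may be lengthened by zero columns of its parity-check matrix.

*The first code.* Fix a nonzero `k`-linear map `τ : K → k` with `τ 1 = 0` and put
`f x = x + τ x`, `g y = y + η τ y`. The `k`-subspaces `{(x, f x, c)}` and `{(y, e, a⁻¹ g y)}` of `K³`,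
with `c, e ∈ k`, have dimension `[K : k] + 1`, so each is a blocking set of the plane over `K`, of at
most `Q + Q / |k| + 1` points. They are disjoint if `a` is not a value of the function
`x ↦ f x * g (x / f x)`. For a suitable `η` this function is not injective, hence not surjective, and
such an `a` exists (`exists_forall_shear_mul_shear_ne`). A point of the plane over the field of order
`q` lies on a line of the subplane, and that line meets both blocking sets; so every nonzero vector is
a combination, with nonzero coefficients, of two vectors of the family (`exists_isSaturating`).

*Larger codimension.* A family `h i` is lifted by replacing `h i` with all vectors `(h i, ξ, β i ξ)`,
where `ξ` runs through an extension of degree `m` and `β i` is a slope. A combination of `h i` and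
`h j` lifts to every vector above it if `β i ≠ β j`; the vectors `(0, a, b)` are obtained from two
lifts of one `h i`, provided that all slopes occur (`IsSaturating.lift`). The members of the family
are therefore put into classes such that two members from distinct classes always suffice, and the
labels `β i` have to separate the classes. A lift doubles the number of classes, while the number
`q ^ m + 1` of labels can be about squared from one lift to the next, so that lifts can be iterated
(`HasSaturatingFamily.iterate`). In the first lift not all slopes can occur, and two vectors are added
(`IsSaturating.lift_of_injective`). The lengths so obtained are the required ones without the term
`f_q(r, R)`.

A code of radius one would need a length of about `q ^ (2 t)`, so the radius is exactly two. The
comparison of the lengths with the earlier bounds is elementary.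
-/

namespace CoveringCode

open Module

/-! ### Codes from families of vectors -/

/-- A finite family of vectors such that every vector is a combination of two members gives, as the
columns of a parity-check matrix, a code of covering radius at most two. The bound on the length
says that the multiples of single columns cannot exhaust the space, so the radius is not smaller. -/
theorem existsCode_two_of_family {F V : Type*} [Field F] [Finite F] [AddCommGroup V] [Module F V]
    [FiniteDimensional F V] {n r : ℕ} (hr : finrank F V = r) (g : Fin n → V)
    (hg : ∀ u, ∃ i j, ∃ c d : F, u = c • g i + d • g j)
    (hn : n * Nat.card F < Nat.card F ^ r) : ExistsCode F n r 2 := by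
  classical
  let L : (Fin n → F) →ₗ[F] V := Fintype.linearCombination F g
  have hLs (i : Fin n) (c : F) : L (Pi.single i c) = c • g i :=
    Fintype.linearCombination_apply_single F g i c
  have hL : Function.Surjective L := by
    intro u
    obtain ⟨i, j, c, d, rfl⟩ := hg u
    exact ⟨Pi.single i c + Pi.single j d, by rw [map_add, hLs, hLs]⟩
  refine ⟨LinearMap.ker L, ?_, ?_, ?_⟩
  · have h := L.finrank_range_add_finrank_ker
    rw [LinearMap.range_eq_top.2 hL, finrank_top, hr] at h
    simp only [finrank_fintype_fun_eq_card, Fintype.card_fin] at h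
    omega
  · intro v
    obtain ⟨i, j, c, d, h⟩ := hg (L v)
    refine ⟨v - (Pi.single i c + Pi.single j d), ?_, ?_⟩
    · rw [LinearMap.mem_ker, map_sub, map_add, hLs, hLs, h, sub_self]
    · refine (Finset.card_le_card (t := {i, j}) ?_).trans Finset.card_le_two
      intro l hl
      simp only [Finset.mem_filter, Finset.mem_univ, true_and] at hl
      simp only [Finset.mem_insert, Finset.mem_singleton]
      by_contra! hl'
      apply hl
      simp [Pi.single_eq_of_ne hl'.1, Pi.single_eq_of_ne hl'.2]
  · intro ρ hρ
    by_contra! hlt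
    -- radius at most one: every vector is a multiple of a single column
    have hsurj : Function.Surjective (fun x : Fin n × F ↦ x.2 • g x.1) := by
      intro u
      obtain ⟨v, rfl⟩ := hL u
      obtain ⟨c, hc, hd⟩ := hρ v
      obtain ⟨i, -⟩ := hg (L v)
      have : Nonempty (Fin n) := ⟨i⟩
      have hcard : (Finset.univ.filter fun i ↦ v i ≠ c i).card ≤ 1 := by
        have : hammingDist v c ≤ 1 := hd.trans (by omega)
        unfold hammingDist at this
        convert this
      rw [Finset.card_le_one_iff_subset_singleton] at hcard
      obtain ⟨l, hl⟩ : ∃ l, ∀ x, x ≠ l → v x = c x := by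
        obtain ⟨l, hl⟩ := hcard
        refine ⟨l, fun x hx ↦ ?_⟩
        by_contra hne
        exact hx (Finset.mem_singleton.1 (hl (by simp [hne])))
      refine ⟨(l, v l - c l), ?_⟩
      have hv : v = c + Pi.single l (v l - c l) := by
        funext x
        by_cases hx : x = l
        · subst hx; simp
        · simp [Pi.single_eq_of_ne hx, hl x hx]
      change (v l - c l) • g l = L v
      conv_rhs => rw [hv, map_add, LinearMap.mem_ker.1 hc, zero_add, hLs]
    have := Nat.card_le_card_of_surjective _ hsurj
    rw [Module.natCard_eq_pow_finrank (K := F) (V := V), hr, Nat.card_prod, Nat.card_fin] at this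
    omega

theorem existsCode_zero (F : Type*) [Field F] : ExistsCode F 0 0 0 :=
  ⟨⊥, by simp, fun v ↦ ⟨0, zero_mem _, by simp [Subsingleton.elim v 0]⟩, fun _ _ ↦ Nat.zero_le _⟩

/-- Covering radii add up in direct sums of codes. -/
theorem ExistsCode.add {F : Type*} [Field F] [Finite F] {n₁ r₁ R₁ n₂ r₂ R₂ : ℕ}
    (h₁ : ExistsCode F n₁ r₁ R₁) (h₂ : ExistsCode F n₂ r₂ R₂) :
    ExistsCode F (n₁ + n₂) (r₁ + r₂) (R₁ + R₂) := by
  classical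
  obtain ⟨C₁, hC₁, hR₁⟩ := h₁
  obtain ⟨C₂, hC₂, hR₂⟩ := h₂
  let e : ((Fin n₁ → F) × (Fin n₂ → F)) ≃ₗ[F] (Fin (n₁ + n₂) → F) :=
    (LinearEquiv.sumArrowLequivProdArrow (Fin n₁) (Fin n₂) F F).symm ≪≫ₗ
      LinearEquiv.funCongrLeft F F finSumFinEquiv.symm
  have hel (x : (Fin n₁ → F) × (Fin n₂ → F)) (i : Fin n₁) :
      e x (finSumFinEquiv (.inl i)) = x.1 i := by
    simp [e, LinearEquiv.funCongrLeft_apply, LinearMap.funLeft_apply]; rfl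
  have her (x : (Fin n₁ → F) × (Fin n₂ → F)) (i : Fin n₂) :
      e x (finSumFinEquiv (.inr i)) = x.2 i := by
    simp [e, LinearEquiv.funCongrLeft_apply, LinearMap.funLeft_apply]; rfl
  have hdist (x y : (Fin n₁ → F) × (Fin n₂ → F)) :
      hammingDist (e x) (e y) = hammingDist x.1 y.1 + hammingDist x.2 y.2 := by
    simp only [hammingDist, Finset.card_filter]
    rw [← finSumFinEquiv.sum_comp, Fintype.sum_sum_type]
    simp only [hel, her]
  have hdist' (x y : (Fin n₁ → F) × (Fin n₂ → F)) {ρ : ℕ} (h : hammingDist (e x) (e y) ≤ ρ) :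
      hammingDist x.1 y.1 + hammingDist x.2 y.2 ≤ ρ := hdist x y ▸ h
  -- words at distance at least `R` from the code
  have hfar {n R : ℕ} {C : Submodule F (Fin n → F)} (h : HasCoveringRadius C R) :
      ∃ v, ∀ c ∈ C, R ≤ hammingDist v c := by
    by_contra! hcon
    rcases R with _ | R
    · obtain ⟨c, -, hc⟩ := hcon 0
      exact absurd hc (Nat.not_lt_zero _)
    · have : R + 1 ≤ R := h.2 fun v ↦ by
        obtain ⟨c, hc, hd⟩ := hcon v
        refine ⟨c, hc, ?_⟩
        have := Nat.lt_succ_iff.1 hd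
        convert this
      omega
  refine ⟨(C₁.prod C₂).map e.toLinearMap, ?_, ?_, ?_⟩
  · have : finrank F (C₁.prod C₂) = finrank F C₁ + finrank F C₂ := by
      have hr : C₁.prod C₂ = LinearMap.range (C₁.subtype.prodMap C₂.subtype) := by
        rw [LinearMap.range_prodMap, C₁.range_subtype, C₂.range_subtype]
      rw [hr, LinearMap.finrank_range_of_inj, finrank_prod]
      exact Subtype.val_injective.prodMap Subtype.val_injective
    rw [LinearEquiv.finrank_map_eq e, this]
    omega
  · intro v
    obtain ⟨x, rfl⟩ := e.surjective v
    obtain ⟨c₁, hc₁, hd₁⟩ := hR₁.1 x.1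
    obtain ⟨c₂, hc₂, hd₂⟩ := hR₂.1 x.2
    refine ⟨e (c₁, c₂), Submodule.mem_map_of_mem ⟨hc₁, hc₂⟩, ?_⟩
    have : hammingDist (e x) (e (c₁, c₂)) ≤ R₁ + R₂ := by
      rw [hdist]
      refine add_le_add ?_ ?_
      · convert hd₁
      · convert hd₂
    convert this
  · intro ρ hρ
    obtain ⟨v₁, hv₁⟩ := hfar hR₁
    obtain ⟨v₂, hv₂⟩ := hfar hR₂
    obtain ⟨_, ⟨c, hc, rfl⟩, hd⟩ := hρ (e (v₁, v₂))
    have h1 := hv₁ _ hc.1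
    have h2 := hv₂ _ hc.2
    have h3 : hammingDist v₁ c.1 + hammingDist v₂ c.2 ≤ ρ := hdist' (v₁, v₂) c hd
    omega

theorem ExistsCode.nsmul {F : Type*} [Field F] [Finite F] {n r R : ℕ} (h : ExistsCode F n r R)
    (s : ℕ) : ExistsCode F (s * n) (s * r) (s * R) := by
  induction s with
  | zero => simpa using existsCode_zero F
  | succ s ih => simpa only [Nat.succ_mul] using ih.add h

/-! ### Saturating families and their lifts -/

/-- Every nonzero vector is a combination, with two nonzero coefficients, of two members of the
family `h` that lie in distinct classes, `κ i` being the class of the index `i`. -/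
def IsSaturating (F : Type*) [Field F] {V ι T : Type*} [AddCommGroup V] [Module F V]
    (h : ι → V) (κ : ι → T) : Prop :=
  ∀ u : V, u ≠ 0 → ∃ i j, κ i ≠ κ j ∧ ∃ c d : F, c ≠ 0 ∧ d ≠ 0 ∧ u = c • h i + d • h j

/-- Some space of dimension `r` over `F` has a saturating family of `n` vectors in `k` classes. -/
def HasSaturatingFamily.{u} (F : Type u) [Field F] (n r k : ℕ) : Prop :=
  ∃ (V : Type u) (_ : AddCommGroup V) (_ : Module F V) (_ : FiniteDimensional F V)
    (h : Fin n → V) (κ : Fin n → Fin k), finrank F V = r ∧ IsSaturating F h κ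

theorem IsSaturating.hasSaturatingFamily.{u} {F V : Type u} {ι T : Type*} [Field F]
    [AddCommGroup V] [Module F V] [FiniteDimensional F V] [Finite ι] [Finite T]
    {h : ι → V} {κ : ι → T} (hs : IsSaturating F h κ) {n r k : ℕ} (hn : Nat.card ι = n)
    (hr : finrank F V = r) (hk : Nat.card T ≤ k) : HasSaturatingFamily F n r k := by
  let e : Fin n ≃ ι := (Finite.equivFinOfCardEq hn).symm
  let f : T → Fin k := fun x ↦ Fin.castLE hk (Finite.equivFin T x)
  have hf : Function.Injective f :=
    (Fin.castLE_injective hk).comp (Finite.equivFin T).injective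
  refine ⟨V, _, _, inferInstance, h ∘ e, f ∘ κ ∘ e, hr, fun u hu ↦ ?_⟩
  obtain ⟨i, j, hij, c, d, hc, hd, rfl⟩ := hs u hu
  exact ⟨e.symm i, e.symm j, by simpa using hf.ne hij, c, d, hc, hd, by simp⟩

/-- The points of the line of `E × E` with a given slope, `none` being the infinite slope. -/
def slopePoint {E : Type*} [Mul E] [Zero E] : Option E → E → E × E
  | some β, ξ => (ξ, β * ξ)
  | none, ξ => (0, ξ)

theorem slopePoint_zero {E : Type*} [Field E] (β : Option E) : slopePoint β 0 = 0 := by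
  cases β <;> simp [slopePoint]

theorem exists_slopePoint_eq {E : Type*} [Field E] (v : E × E) :
    ∃ β ξ, slopePoint β ξ = v := by
  by_cases h : v.1 = 0
  · exact ⟨none, v.2, by ext <;> simp [slopePoint, h]⟩
  · exact ⟨some (v.2 / v.1), v.1, by ext <;> simp [slopePoint, h]⟩

/-- Lines of distinct slopes span the plane. -/
theorem exists_smul_slopePoint_add {F E : Type*} [Field F] [Field E] [Algebra F E]
    {β γ : Option E} (hβγ : β ≠ γ) {c d : F} (hc : c ≠ 0) (hd : d ≠ 0) (v : E × E) :
    ∃ ξ η, c • slopePoint β ξ + d • slopePoint γ η = v := by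
  obtain ⟨a, b⟩ := v
  -- the coefficients may be absorbed into the points
  suffices ∃ ξ η, slopePoint β ξ + slopePoint γ η = (a, b) by
    obtain ⟨ξ, η, h⟩ := this
    refine ⟨c⁻¹ • ξ, d⁻¹ • η, ?_⟩
    rw [← h]
    cases β <;> cases γ <;> simp [slopePoint, smul_smul, hc, hd]
  rcases β with _ | β <;> rcases γ with _ | γ
  · exact absurd rfl hβγ
  · exact ⟨b - γ * a, a, by simp [slopePoint]⟩
  · exact ⟨a, b - β * a, by simp [slopePoint]⟩
  · have h : β - γ ≠ 0 := sub_ne_zero.2 fun h ↦ hβγ (congrArg some h)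
    refine ⟨(b - γ * a) / (β - γ), (β * a - b) / (β - γ), ?_⟩
    ext <;> simp only [slopePoint, Prod.mk_add_mk] <;> field_simp <;> ring

/-- A classification into at most `|L| ≤ |ι|` classes is refined by a surjective labelling. -/
theorem exists_surjective_refinement {ι T L : Type*} [Finite ι] [Finite T] [Finite L] (κ : ι → T)
    (h₁ : Nat.card T ≤ Nat.card L) (h₂ : Nat.card L ≤ Nat.card ι) :
    ∃ β : ι → L, Function.Surjective β ∧ ∀ i j, κ i ≠ κ j → β i ≠ β j := by
  classical
  cases nonempty_fintype ι
  cases nonempty_fintype T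
  cases nonempty_fintype L
  simp only [Nat.card_eq_fintype_card] at h₁ h₂
  -- one representative of each class, enlarged to a set with as many elements as there are labels
  choose τ hτ using fun x : Set.range κ ↦ x.2
  let σ (i : ι) : ι := τ ⟨κ i, i, rfl⟩
  have hσκ (i : ι) : κ (σ i) = κ i := hτ _
  let S₀ : Finset ι := Finset.univ.image τ
  have hS₀ : S₀.card ≤ Fintype.card L :=
    Finset.card_image_le.trans ((Fintype.card_le_of_injective _ Subtype.val_injective).trans h₁)
  obtain ⟨S, hS, hScard⟩ := Finset.exists_superset_card_eq hS₀ h₂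
  have e : S ≃ L := Fintype.equivOfCardEq (by simp [hScard])
  have hmem (i : ι) : σ i ∈ S := hS (Finset.mem_image_of_mem _ (Finset.mem_univ _))
  refine ⟨fun i ↦ if hi : i ∈ S then e ⟨i, hi⟩ else e ⟨σ i, hmem i⟩, fun l ↦ ?_,
    fun i j hij hβ ↦ hij ?_⟩
  · exact ⟨e.symm l, by simp⟩
  · dsimp only at hβ
    split_ifs at hβ with hi hj hj <;>
      simp only [EmbeddingLike.apply_eq_iff_eq, Subtype.mk.injEq] at hβ
    · rw [hβ]
    · rw [hβ, hσκ]
    · rw [← hβ, hσκ]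
    · rw [← hσκ i, hβ, hσκ]

/-- Lift of a saturating family along an extension field `E`: each vector `h i` is replaced by the
vectors `(h i, ξ, β i ξ)`. As the labels `β i` exhaust all slopes, the vectors `(0, a, b)` are
differences of two lifts of one vector; for this each class is split into the lifts with `ξ = 0`
and the others. -/
theorem IsSaturating.lift {F V E ι T : Type*} [Field F] [AddCommGroup V] [Module F V]
    [Field E] [Algebra F E] [DecidableEq E] {h : ι → V} {κ : ι → T} (hs : IsSaturating F h κ)
    {β : ι → Option E} (hβ : Function.Surjective β) (hκβ : ∀ i j, κ i ≠ κ j → β i ≠ β j) :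
    IsSaturating F (fun x : ι × E ↦ (h x.1, slopePoint (β x.1) x.2))
      (fun x ↦ (κ x.1, decide (x.2 = 0))) := by
  rintro ⟨u, v⟩ huv
  by_cases hu : u = 0
  · obtain ⟨b, ξ, rfl⟩ := exists_slopePoint_eq v
    obtain ⟨i, rfl⟩ := hβ b
    have hξ : ξ ≠ 0 := by
      rintro rfl
      exact huv (by rw [hu, slopePoint_zero]; rfl)
    refine ⟨(i, ξ), (i, 0), by simp [hξ], 1, -1, one_ne_zero, by simp, ?_⟩
    simp [hu, slopePoint_zero]
  · obtain ⟨i, j, hij, c, d, hc, hd, rfl⟩ := hs u hu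
    obtain ⟨ξ, η, rfl⟩ := exists_smul_slopePoint_add (hκβ i j hij) hc hd v
    exact ⟨(i, ξ), (j, η), fun h ↦ hij (congrArg Prod.fst h), c, d, hc, hd, rfl⟩

theorem HasSaturatingFamily.lift {F : Type*} [Field F] [Finite F] {n r k m : ℕ}
    (hs : HasSaturatingFamily F n r k) (hm : m ≠ 0) (hk : k ≤ Nat.card F ^ m + 1)
    (hn : Nat.card F ^ m + 1 ≤ n) :
    HasSaturatingFamily F (n * Nat.card F ^ m) (r + 2 * m) (2 * k) := by
  classical
  obtain ⟨V, _, _, _, h, κ, hr, hs⟩ := hs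
  obtain ⟨p, _⟩ := CharP.exists F
  have : Fact p.Prime := ⟨CharP.char_is_prime F p⟩
  have : NeZero m := ⟨hm⟩
  let E := FiniteField.Extension F p m
  have hE : Nat.card E = Nat.card F ^ m := FiniteField.natCard_extension F p m
  have hO : Nat.card (Option E) = Nat.card F ^ m + 1 := by rw [Finite.card_option, hE]
  obtain ⟨β, hβ, hκβ⟩ := exists_surjective_refinement (L := Option E) κ (by simpa [hO])
    (by simpa [hO])
  refine (hs.lift hβ hκβ).hasSaturatingFamily ?_ ?_ ?_
  · simp [hE]
  · rw [finrank_prod, finrank_prod, hr, FiniteField.finrank_extension F p m]; ring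
  · simp [mul_comm]

/-- Lift of a short saturating family of singleton classes. The slopes are too many to be all used
as labels; instead, the vectors `(0, 1, 0)` and `(0, 0, 1)` are added. The vectors `(0, a, 0)` and
`(0, 0, b)` are obtained from the labels `0` and `∞`, whose classes are split. -/
theorem IsSaturating.lift_of_injective {F V ι : Type*} [Field F] [AddCommGroup V] [Module F V]
    [DecidableEq F] {h : ι → V} (hs : IsSaturating F h id)
    {β : ι → Option F} (hβ : Function.Injective β) {i₀ i₁ : ι} (h₀ : β i₀ = some 0)
    (h₁ : β i₁ = none) :
    IsSaturating F
      (Sum.elim (fun x : ι × F ↦ (h x.1, slopePoint (β x.1) x.2))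
        (fun b : Bool ↦ (0, if b then (1, 0) else (0, 1))))
      (Sum.elim (fun x : ι × F ↦ if x.2 = 0 ∧ β x.1 = some 0 then Sum.inr 0
        else if x.2 = 0 ∧ β x.1 = none then Sum.inr 1 else Sum.inl x.1)
        (fun b : Bool ↦ Sum.inr (if b then 2 else 3 : Fin 4))) := by
  rintro ⟨u, a, b⟩ huv
  by_cases hu : u = 0
  · subst hu
    by_cases ha : a = 0
    · have hb : b ≠ 0 := fun hb ↦ huv (by rw [ha, hb]; rfl)
      refine ⟨.inl (i₁, b), .inl (i₁, 0), by simp [hb, h₁], 1, -1, one_ne_zero, by simp, ?_⟩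
      simp [ha, h₁, slopePoint]
    by_cases hb : b = 0
    · refine ⟨.inl (i₀, a), .inl (i₀, 0), by simp [ha, h₀], 1, -1, one_ne_zero, by simp, ?_⟩
      simp [hb, h₀, slopePoint]
    · exact ⟨.inr true, .inr false, by simp, a, b, ha, hb, by simp⟩
  · obtain ⟨i, j, hij, c, d, hc, hd, rfl⟩ := hs u hu
    obtain ⟨ξ, η, h⟩ := exists_smul_slopePoint_add (hβ.ne hij) hc hd (a, b)
    refine ⟨.inl (i, ξ), .inl (j, η), ?_, c, d, hc, hd, by simp [← h]⟩
    simp only [Sum.elim_inl]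
    intro hcl
    split_ifs at hcl with h1 h2 h3 h4 h5 h6
    · exact hij (hβ (h1.2.trans h2.2.symm))
    · simp at hcl
    · simp at hcl
    · exact hij (hβ (h4.2.trans h6.2.symm))
    · exact hij (Sum.inl_injective hcl)

theorem IsSaturating.hasSaturatingFamily_lift.{u} {F V : Type u} {ι : Type*} [Field F] [Finite F]
    [AddCommGroup V] [Module F V] [FiniteDimensional F V] [Finite ι] {h : ι → V}
    (hs : IsSaturating F h id) (h₂ : 2 ≤ Nat.card ι) (hq : Nat.card ι ≤ Nat.card F + 1) :
    HasSaturatingFamily F (Nat.card ι * Nat.card F + 2) (finrank F V + 2) (Nat.card ι + 4) := by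
  classical
  cases nonempty_fintype ι
  cases nonempty_fintype F
  obtain ⟨S, hS, -, hcard⟩ := Finset.exists_subsuperset_card_eq
    (Finset.subset_univ ({none, some 0} : Finset (Option F))) (n := Nat.card ι)
    (by rwa [Finset.card_pair (by simp)])
    (by rwa [Finset.card_univ, Fintype.card_option, ← Nat.card_eq_fintype_card])
  have e : ι ≃ S := Fintype.equivOfCardEq (by simp [hcard])
  refine (hs.lift_of_injective (β := fun i ↦ (e i : Option F))
    (Subtype.val_injective.comp e.injective) (i₀ := e.symm ⟨some 0, hS (by simp)⟩)
    (i₁ := e.symm ⟨none, hS (by simp)⟩) (by simp) (by simp)).hasSaturatingFamily ?_ ?_ ?_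
  · simp
  · simp only [finrank_prod, finrank_self]
  · simp

/-- Iterated lifts. The degree of each extension is about half of the final exponent, so that the
number of classes, which doubles with each lift, stays below the number of labels. -/
theorem HasSaturatingFamily.iterate {F : Type*} [Field F] [Finite F] {n r k : ℕ}
    (hs : HasSaturatingFamily F n r k) (hq : 3 ≤ Nat.card F)
    (hk : 2 * k ≤ Nat.card F + 1) (hn : Nat.card F + 1 ≤ n)
    (u : ℕ) (hu : 1 ≤ u) :
    HasSaturatingFamily F (n * Nat.card F ^ u) (r + 2 * u) (Nat.card F ^ u + 1) := by
  generalize hQ : Nat.card F = q at *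
  have mono {n r k k' : ℕ} (hs : HasSaturatingFamily F n r k) (hkk : k ≤ k') :
      HasSaturatingFamily F n r k' := by
    obtain ⟨V, _, _, _, h, κ, hr, hs⟩ := hs
    exact hs.hasSaturatingFamily (by simp) hr (by simpa)
  induction u using Nat.strong_induction_on with
  | _ u ih =>
    rcases hu.eq_or_lt with rfl | hu
    · rw [pow_one]
      have := hs.lift one_ne_zero (by rw [hQ, pow_one]; omega) (by rw [hQ, pow_one]; omega)
      rw [hQ, pow_one] at this
      exact mono this (by omega)
    · have hs' := ih (u / 2) (by omega) (by omega)
      have hle : q ^ (u / 2) ≤ q ^ (u - u / 2) := Nat.pow_le_pow_right (by omega) (by omega)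
      have hle' : q ^ (u - u / 2) ≤ q ^ (u / 2 + 1) := Nat.pow_le_pow_right (by omega) (by omega)
      have hlt : q ^ (u / 2 + 1) ≤ q ^ u := Nat.pow_le_pow_right (by omega) (by omega)
      have hpos : 1 ≤ q ^ (u / 2) := Nat.one_le_pow _ _ (by omega)
      have h := hs'.lift (m := u - u / 2) (by omega) (by rw [hQ]; omega)
        (by rw [hQ]; rw [pow_succ'] at hle'; nlinarith)
      rw [hQ, mul_assoc, ← pow_add, Nat.add_sub_cancel' (by omega : u / 2 ≤ u),
        show r + 2 * (u / 2) + 2 * (u - u / 2) = r + 2 * u by omega] at h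
      refine mono h ?_
      rw [pow_succ'] at hlt
      nlinarith

/-! ### Linear blocking sets and saturation over a quadratic extension -/

section Blocking

variable {k K F : Type*} [Field k] [Field K] [Field F] [Algebra k K] [Algebra K F]

theorem exists_dual_ne_zero_of_finrank_lt {U : Type*} [AddCommGroup U] [Module K U]
    [FiniteDimensional K U] {S : Submodule K U} (hS : finrank K S < finrank K U) :
    ∃ ℓ : U →ₗ[K] K, ℓ ≠ 0 ∧ ∀ x ∈ S, ℓ x = 0 := by
  obtain ⟨ℓ, hℓ, hS⟩ := S.exists_le_ker_of_lt_top
    (lt_top_iff_ne_top.2 fun h ↦ by rw [h, finrank_top] at hS; exact lt_irrefl _ hS)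
  exact ⟨ℓ, hℓ, fun x hx ↦ hS hx⟩

theorem exists_eq_smul_add_smul {ℓ : K × K × K →ₗ[K] K} (hℓ : ℓ ≠ 0) {w w' a : K × K × K}
    (hw : ℓ w = 0) (hw' : ℓ w' = 0) (hli : LinearIndependent K ![w, w']) (ha : ℓ a = 0) :
    ∃ c d : K, a = c • w + d • w' := by
  have hspan : Submodule.span K {w, w'} = LinearMap.ker ℓ := by
    refine Submodule.eq_of_le_of_finrank_eq ?_ ?_
    · rw [Submodule.span_le]
      rintro x (rfl | rfl)
      exacts [hw, hw']
    · have h1 := finrank_span_eq_card hli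
      rw [Matrix.range_cons_cons_empty, Fintype.card_fin] at h1
      have h2 := ℓ.finrank_range_add_finrank_ker
      rw [LinearMap.range_eq_top.2 (LinearMap.surjective hℓ), finrank_top] at h2
      simp only [finrank_prod, finrank_self] at h2
      omega
  have : a ∈ Submodule.span K {w, w'} := hspan ▸ ha
  obtain ⟨c, d, h⟩ := Submodule.mem_span_pair.1 this
  exact ⟨c, d, h.symm⟩

variable (F) in
/-- The inclusion of `K³` in `F³`. -/
def baseChange (w : K × K × K) : F × F × F :=
  (algebraMap K F w.1, algebraMap K F w.2.1, algebraMap K F w.2.2)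

theorem baseChange_smul (c : K) (w : K × K × K) : baseChange F (c • w) = c • baseChange F w := by
  simp [baseChange, Algebra.smul_def]

theorem baseChange_add (w w' : K × K × K) :
    baseChange F (w + w') = baseChange F w + baseChange F w' := by
  simp [baseChange]

theorem exists_eq_smul_baseChange_add (b : Basis (Fin 2) K F) (u : F × F × F) :
    ∃ a a' : K × K × K, u = b 0 • baseChange F a + b 1 • baseChange F a' := by
  have h (x : F) : x = b 0 * algebraMap K F (b.repr x 0) + b 1 * algebraMap K F (b.repr x 1) := by
    conv_lhs => rw [← b.sum_repr x]
    simp [Fin.sum_univ_two, Algebra.smul_def, mul_comm]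
  refine ⟨(b.repr u.1 0, b.repr u.2.1 0, b.repr u.2.2 0),
    (b.repr u.1 1, b.repr u.2.1 1, b.repr u.2.2 1), ?_⟩
  ext
  exacts [h _, h _, h _]

/-- In a projective plane over `K`, let two disjoint blocking sets be given by `k`-subspaces `W b`.
Every point of the plane is a combination of two distinct points of their union. A point of one of
the sets, say of the vector `w`, is obtained from `w = (w + w') - w'`. -/
theorem exists_pair_of_blocking {W : Bool → Submodule k (K × K × K)}
    (hblock : ∀ b, ∀ ℓ : K × K × K →ₗ[K] K, ∃ w ∈ W b, w ≠ 0 ∧ ℓ w = 0)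
    (hdisj : ∀ w ∈ W true, ∀ w' ∈ W false, w ≠ 0 → w' ≠ 0 → LinearIndependent K ![w, w'])
    {a : K × K × K} (ha : a ≠ 0) :
    ∃ b b', ∃ w ∈ W b, ∃ w' ∈ W b', LinearIndependent K ![w, w'] ∧
      ∃ c d : K, c ≠ 0 ∧ d ≠ 0 ∧ a = c • w + d • w' := by
  have hself (b : Bool) (w : K × K × K) (hw : w ∈ W b) (hw0 : w ≠ 0) (d : K) (had : a = d • w) :
      ∃ b b', ∃ w ∈ W b, ∃ w' ∈ W b', LinearIndependent K ![w, w'] ∧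
        ∃ c d : K, c ≠ 0 ∧ d ≠ 0 ∧ a = c • w + d • w' := by
    have hd : d ≠ 0 := by
      rintro rfl
      exact ha (by rw [had, zero_smul])
    obtain ⟨ℓ, hℓ⟩ : ∃ ℓ : K × K × K →ₗ[K] K, ℓ w ≠ 0 := by
      by_contra! h
      exact hw0 ((forall_dual_apply_eq_zero_iff K w).1 h)
    obtain ⟨w', hw', hw'0, hℓ'⟩ := hblock b ℓ
    refine ⟨b, b, w + w', add_mem hw hw', w', hw', ?_, d, -d, hd, neg_ne_zero.2 hd, ?_⟩
    · rw [LinearIndependent.pair_iff]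
      intro s t hst
      have hs : s = 0 := by
        have := congrArg ℓ hst
        simpa [hℓ', hℓ] using this
      subst hs
      simpa [hw'0] using hst
    · rw [had]; module
  obtain ⟨ℓ, hℓ, hℓa⟩ := exists_dual_ne_zero_of_finrank_lt (K := K) (S := K ∙ a) (by
    rw [finrank_span_singleton ha]; simp [finrank_prod])
  obtain ⟨w, hw, hw0, hℓw⟩ := hblock true ℓ
  obtain ⟨w', hw', hw'0, hℓw'⟩ := hblock false ℓ
  have hli := hdisj w hw w' hw' hw0 hw'0
  obtain ⟨c, d, hacd⟩ := exists_eq_smul_add_smul hℓ hℓw hℓw' hli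
    (hℓa a (Submodule.mem_span_singleton_self a))
  by_cases hc : c = 0
  · exact hself _ w' hw' hw'0 d (by rw [hacd, hc]; simp)
  by_cases hd : d = 0
  · exact hself _ w hw hw0 c (by rw [hacd, hd]; simp)
  exact ⟨_, _, w, hw, w', hw', hli, c, d, hc, hd, hacd⟩

/-- Two disjoint blocking sets of the subplane over `K` saturate the plane over a quadratic
extension `F`: a point outside the subplane lies on a line of the subplane, and this line contains
a point of each of them. -/
theorem isSaturating_baseChange (hF : finrank K F = 2) {W : Bool → Submodule k (K × K × K)}
    (hblock : ∀ b, ∀ ℓ : K × K × K →ₗ[K] K, ∃ w ∈ W b, w ≠ 0 ∧ ℓ w = 0)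
    (hdisj : ∀ w ∈ W true, ∀ w' ∈ W false, w ≠ 0 → w' ≠ 0 → LinearIndependent K ![w, w'])
    {ι : Type*} {h : ι → K × K × K} (hh : ∀ b, ∀ w ∈ W b, ∃ i, ∃ c : K, w = c • h i) :
    IsSaturating F (fun i ↦ baseChange F (h i)) id := by
  intro u hu
  -- it suffices to write `u` by independent vectors of the subspaces `W b`
  suffices ∃ b b', ∃ w ∈ W b, ∃ w' ∈ W b', LinearIndependent K ![w, w'] ∧
      ∃ c d : F, c ≠ 0 ∧ d ≠ 0 ∧ u = c • baseChange F w + d • baseChange F w' by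
    obtain ⟨b, b', w, hw, w', hw', hli, c, d, hc, hd, rfl⟩ := this
    rw [LinearIndependent.pair_iff] at hli
    obtain ⟨i, γ, rfl⟩ := hh b w hw
    obtain ⟨j, δ, rfl⟩ := hh b' w' hw'
    have hγ : γ ≠ 0 := by
      rintro rfl
      simpa using hli 1 0 (by simp)
    have hδ : δ ≠ 0 := by
      rintro rfl
      simpa using hli 0 1 (by simp)
    refine ⟨i, j, ?_, c * algebraMap K F γ, d * algebraMap K F δ, by simp [hc, hγ],
      by simp [hd, hδ], ?_⟩
    · rintro (rfl : i = j)
      exact hδ (hli δ (-γ) (by module)).1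
    · simp only [baseChange_smul, mul_smul, algebraMap_smul]
  have : FiniteDimensional K F := FiniteDimensional.of_finrank_pos (by omega)
  let b : Basis (Fin 2) K F := finBasisOfFinrankEq K F hF
  have hb (s t : K) (h : b 0 * algebraMap K F s + b 1 * algebraMap K F t = 0) :
      s = 0 ∧ t = 0 := by
    have := Fintype.linearIndependent_iff.1 b.linearIndependent ![s, t]
      (by simpa [Fin.sum_univ_two, Algebra.smul_def, mul_comm] using h)
    exact ⟨this 0, this 1⟩
  obtain ⟨a, a', rfl⟩ := exists_eq_smul_baseChange_add b u
  by_cases hli : LinearIndependent K ![a, a']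
  · obtain ⟨ℓ, hℓ, hℓa⟩ := exists_dual_ne_zero_of_finrank_lt (K := K)
      (S := Submodule.span K (Set.range ![a, a'])) (by
        rw [finrank_span_eq_card hli]; simp [finrank_prod])
    obtain ⟨w, hw, hw0, hℓw⟩ := hblock true ℓ
    obtain ⟨w', hw', hw'0, hℓw'⟩ := hblock false ℓ
    have hww := hdisj w hw w' hw' hw0 hw'0
    obtain ⟨c, d, rfl⟩ := exists_eq_smul_add_smul hℓ hℓw hℓw' hww
      (hℓa a (Submodule.subset_span ⟨0, rfl⟩))
    obtain ⟨c', d', rfl⟩ := exists_eq_smul_add_smul hℓ hℓw hℓw' hww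
      (hℓa a' (Submodule.subset_span ⟨1, rfl⟩))
    rw [LinearIndependent.pair_iff] at hli
    refine ⟨_, _, w, hw, w', hw', hww, b 0 * algebraMap K F c + b 1 * algebraMap K F c',
      b 0 * algebraMap K F d + b 1 * algebraMap K F d', fun h ↦ ?_, fun h ↦ ?_, ?_⟩
    · obtain ⟨rfl, rfl⟩ := hb _ _ h
      obtain ⟨rfl, h2⟩ := hli d' (-d) (by module)
      have := hli 1 1 (by rw [neg_eq_zero.1 h2]; module)
      exact one_ne_zero this.1
    · obtain ⟨rfl, rfl⟩ := hb _ _ h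
      obtain ⟨rfl, h2⟩ := hli c' (-c) (by module)
      have := hli 1 1 (by rw [neg_eq_zero.1 h2]; module)
      exact one_ne_zero this.1
    · simp only [baseChange_add, baseChange_smul, ← algebraMap_smul F c, ← algebraMap_smul F d,
        ← algebraMap_smul F c', ← algebraMap_smul F d']
      module
  · -- otherwise `u` is a multiple of a point of the subplane
    obtain ⟨γ, v, hv⟩ : ∃ (γ : F) (v : K × K × K),
        b 0 • baseChange F a + b 1 • baseChange F a' = γ • baseChange F v := by
      rw [LinearIndependent.pair_iff] at hli
      push Not at hli
      obtain ⟨s, t, hst, h⟩ := hli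
      by_cases hs : s = 0
      · have ht := h hs
        have : a' = 0 := by simpa [hs, ht] using hst
        exact ⟨b 0, a, by simp [this, baseChange]⟩
      · have : a = (-(t / s)) • a' := by
          rw [← sub_eq_zero, ← smul_eq_zero_iff_right hs, ← hst]
          rw [smul_sub, smul_smul]
          have : s * -(t / s) = -t := by field_simp
          rw [this]; module
        refine ⟨b 0 * algebraMap K F (-(t / s)) + b 1, a', ?_⟩
        rw [this, baseChange_smul, ← algebraMap_smul F]
        module
    rw [hv] at hu ⊢
    have hγ : γ ≠ 0 := by
      rintro rfl
      exact hu (zero_smul _ _)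
    have hv0 : v ≠ 0 := by
      rintro rfl
      exact hu (by simp [baseChange])
    obtain ⟨b, b', w, hw, w', hw', hli, c, d, hc, hd, rfl⟩ :=
      exists_pair_of_blocking hblock hdisj hv0
    refine ⟨b, b', w, hw, w', hw', hli, γ * algebraMap K F c, γ * algebraMap K F d,
      by simp [hγ, hc], by simp [hγ, hd], ?_⟩
    simp only [baseChange_add, baseChange_smul, ← algebraMap_smul F c, ← algebraMap_smul F d]
    module

end Blocking

/-! ### Two disjoint blocking sets of trace type -/

section Shear

variable {k K : Type*} [Field k] [Field K] [Algebra k K]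

/-- The map `x ↦ x + ε τ(x)`. -/
def shear (τ : K →ₗ[k] k) (ε : k) : K →ₗ[k] K :=
  LinearMap.id + Algebra.linearMap k K ∘ₗ (ε • τ)

theorem shear_apply (τ : K →ₗ[k] k) (ε : k) (x : K) :
    shear τ ε x = x + algebraMap k K (ε * τ x) := by
  simp [shear]

variable {τ : K →ₗ[k] k}

theorem map_algebraMap_eq_zero (h₁ : τ 1 = 0) (c : k) : τ (algebraMap k K c) = 0 := by
  rw [Algebra.algebraMap_eq_smul_one, map_smul, h₁, smul_zero]

theorem shear_ne_zero (h₁ : τ 1 = 0) (ε : k) {x : K} (hx : x ≠ 0) : shear τ ε x ≠ 0 := by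
  intro h
  have h2 : τ x = 0 := by
    have := congrArg τ h
    rwa [shear_apply, map_add, map_algebraMap_eq_zero h₁, add_zero, map_zero] at this
  rw [shear_apply, h2] at h
  exact hx (by simpa using h)

/-- The element `a` making the sets `(x, f x, c)` and `(y, e, a⁻¹ g y)` disjoint, where `f` and `g`
are shears. The function `x ↦ f x * g (x / f x)` fixes `k`, and it takes a value in `k` at the
point `z - τ z` outside `k`; thus it is not injective, hence not surjective. -/
theorem exists_forall_shear_mul_shear_ne [Finite K] (h₁ : τ 1 = 0) {z : K} (hz : τ z ≠ 0)
    (hz' : τ z⁻¹ ≠ 0) :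
    ∃ η : k, ∃ a : K, a ≠ 0 ∧ ∀ x, shear τ 1 x * shear τ η (x / shear τ 1 x) ≠ a := by
  let η : k := (τ z * τ z⁻¹)⁻¹
  let v : K → K := fun x ↦ shear τ 1 x * shear τ η (x / shear τ 1 x)
  have hz0 : z ≠ 0 := by
    rintro rfl
    simp at hz
  have hvk (c : k) : v (algebraMap k K c) = algebraMap k K c := by
    have hs (ε c : k) : shear τ ε (algebraMap k K c) = algebraMap k K c := by
      rw [shear_apply, map_algebraMap_eq_zero h₁, mul_zero, map_zero, add_zero]
    by_cases hc : algebraMap k K c = 0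
    · simp [v, hc]
    · have h1 := hs η 1
      rw [map_one] at h1
      simp only [v]
      rw [hs, div_self hc, h1, mul_one]
  have hvz : v (z - algebraMap k K (τ z)) = algebraMap k K (-τ z) := by
    have h1 : shear τ 1 (z - algebraMap k K (τ z)) = z := by
      rw [shear_apply, map_sub, map_algebraMap_eq_zero h₁, sub_zero, one_mul, sub_add_cancel]
    have h2 : τ ((z - algebraMap k K (τ z)) / z) = -(τ z * τ z⁻¹) := by
      rw [sub_div, div_self hz0, map_sub, h₁, zero_sub, div_eq_mul_inv, ← Algebra.smul_def,
        map_smul, smul_eq_mul]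
    simp only [v]
    rw [h1, shear_apply, h2, mul_neg, inv_mul_cancel₀ (mul_ne_zero hz hz'), map_neg, map_one,
      mul_add, mul_div_cancel₀ _ hz0, map_neg]
    ring
  have hv : ¬ Function.Surjective v := by
    rw [← Finite.injective_iff_surjective]
    intro hinj
    have h := hinj (hvz.trans (hvk (-τ z)).symm)
    rw [map_neg, sub_eq_neg_self] at h
    exact hz0 h
  simp only [Function.Surjective, not_forall, not_exists] at hv
  obtain ⟨a, ha⟩ := hv
  refine ⟨η, a, ?_, ha⟩
  rintro rfl
  exact ha 0 (by simp [v])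

/-- The vectors `(x, f x, c)`, where `f = shear τ 1`, and `(y, e, a⁻¹ g y)`, where
`g = shear τ η`, of two disjoint linear blocking sets. -/
def blockingMap (τ : K →ₗ[k] k) (η : k) (a : K) : Bool → K × k →ₗ[k] K × K × K
  | true => (LinearMap.fst k K k).prod
      ((shear τ 1 ∘ₗ LinearMap.fst k K k).prod (Algebra.linearMap k K ∘ₗ LinearMap.snd k K k))
  | false => (LinearMap.fst k K k).prod
      ((Algebra.linearMap k K ∘ₗ LinearMap.snd k K k).prod
        (LinearMap.mulLeft k a⁻¹ ∘ₗ shear τ η ∘ₗ LinearMap.fst k K k))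

theorem blockingMap_true (η : k) (a : K) (x : K × k) :
    blockingMap τ η a true x = (x.1, shear τ 1 x.1, algebraMap k K x.2) := rfl

theorem blockingMap_false (η : k) (a : K) (x : K × k) :
    blockingMap τ η a false x = (x.1, algebraMap k K x.2, a⁻¹ * shear τ η x.1) := rfl

theorem blockingMap_injective (η : k) (a : K) (b : Bool) :
    Function.Injective (blockingMap τ η a b) := by
  rintro ⟨x, c⟩ ⟨y, e⟩ h
  cases b <;>
    simp only [blockingMap_true, blockingMap_false, Prod.mk.injEq,
      (algebraMap k K).injective.eq_iff] at h <;> ext <;> simp [h]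

theorem linearIndependent_blockingMap (h₁ : τ 1 = 0) {η : k} {a : K} (ha : a ≠ 0)
    (hv : ∀ x, shear τ 1 x * shear τ η (x / shear τ 1 x) ≠ a) {p p' : K × k} (hp : p ≠ 0)
    (hp' : p' ≠ 0) :
    LinearIndependent K ![blockingMap τ η a true p, blockingMap τ η a false p'] := by
  have hne : blockingMap τ η a true p ≠ 0 := by
    rw [Ne, map_eq_zero_iff _ (blockingMap_injective η a _)]; exact hp
  have hne' : blockingMap τ η a false p' ≠ 0 := by
    rw [Ne, map_eq_zero_iff _ (blockingMap_injective η a _)]; exact hp'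
  rw [LinearIndependent.pair_iff' hne]
  intro l h
  have hl : l ≠ 0 := by
    rintro rfl
    exact hne' (by rw [← h, zero_smul])
  obtain ⟨x, c⟩ := p
  obtain ⟨y, e⟩ := p'
  simp only [blockingMap_true, blockingMap_false, Prod.smul_mk, Prod.mk.injEq, smul_eq_mul] at h
  obtain ⟨hxy, hfx, hgy⟩ := h
  by_cases hx : x = 0
  · subst hx
    have hy : y = 0 := by simpa using hxy.symm
    subst hy
    rw [map_zero, mul_zero, mul_eq_zero, or_iff_right hl,
      map_eq_zero] at hgy
    exact hp (by rw [hgy]; rfl)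
  have hy : y ≠ 0 := by rw [← hxy]; exact mul_ne_zero hl hx
  have hf := shear_ne_zero h₁ 1 hx
  have hc : algebraMap k K c ≠ 0 := by
    intro hc
    rw [hc, mul_zero] at hgy
    exact mul_ne_zero (inv_ne_zero ha) (shear_ne_zero h₁ η hy) hgy.symm
  have hc0 : c ≠ 0 := by rintro rfl; simp at hc
  -- by homogeneity, the function takes the value `a` at `x / c`
  have he : algebraMap k K e ≠ 0 := by rw [← hfx]; exact mul_ne_zero hl hf
  have hdiv : x / shear τ 1 x = e⁻¹ • y := by
    rw [Algebra.smul_def, map_inv₀, ← hfx, ← hxy]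
    field_simp
  refine hv (c⁻¹ • x) ?_
  have hquot : c⁻¹ • x / c⁻¹ • shear τ 1 x = e⁻¹ • y := by
    rw [← hdiv, Algebra.smul_def, Algebra.smul_def, mul_div_mul_left _ _ (by simpa using hc0)]
  rw [map_smul, hquot, map_smul, Algebra.smul_def, Algebra.smul_def, map_inv₀, map_inv₀]
  have hg : shear τ η y = a * (l * algebraMap k K c) := by
    rw [hgy, mul_inv_cancel_left₀ ha]
  rw [hg, ← hfx]
  field_simp

/-- Projective representatives of the vectors of a linear set: the three summands parametrize the
points with `c = 1`, those with `c = 0` and `τ x = 1`, and the point `x = 1` common to all of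
`ker τ`. -/
def representative (τ : K →ₗ[k] k) : K ⊕ {x : K // τ x = 1} ⊕ Unit → K × k
  | .inl x => (x, 1)
  | .inr (.inl x) => (x, 0)
  | .inr (.inr _) => (1, 0)

theorem exists_eq_smul_representative {U : Type*} [AddCommGroup U] [Module K U] [Module k U]
    [IsScalarTower k K U] (φ : K × k →ₗ[k] U) (hφ : ∀ x, τ x = 0 → φ (x, 0) = x • φ (1, 0))
    (p : K × k) : ∃ i, ∃ c : K, φ p = c • φ (representative τ i) := by
  obtain ⟨x, c⟩ := p
  by_cases hc : c = 0
  · subst hc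
    by_cases hx : τ x = 0
    · exact ⟨.inr (.inr ()), x, hφ x hx⟩
    · refine ⟨.inr (.inl ⟨(τ x)⁻¹ • x, by simp [hx]⟩), algebraMap k K (τ x), ?_⟩
      rw [algebraMap_smul, ← map_smul]
      simp [representative, hx, smul_smul]
  · refine ⟨.inl (c⁻¹ • x), algebraMap k K c, ?_⟩
    rw [algebraMap_smul, ← map_smul]
    simp [representative, hc, smul_smul]

theorem card_fiber_mul [Finite K] (hτ : Function.Surjective τ) :
    Nat.card {x : K // τ x = 1} * Nat.card k = Nat.card K ∧
      Nat.card (LinearMap.ker τ) * Nat.card k = Nat.card K := by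
  obtain ⟨y, hy⟩ := hτ 1
  have h1 : Nat.card (LinearMap.ker τ) * Nat.card k = Nat.card K := by
    rw [(LinearMap.ker τ).card_eq_card_quotient_mul_card,
      Nat.card_congr (τ.quotKerEquivOfSurjective hτ).toEquiv]
  have h2 : Nat.card {x : K // τ x = 1} = Nat.card (LinearMap.ker τ) :=
    Nat.card_congr
      { toFun := fun x ↦ ⟨x - y, by simp [x.2, hy]⟩
        invFun := fun x ↦ ⟨x + y, by simp [hy, LinearMap.mem_ker.1 x.2]⟩
        left_inv := fun x ↦ by simp
        right_inv := fun x ↦ by simp }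
  exact ⟨h2 ▸ h1, h1⟩

/-- The hyperplane `ker τ` and its image under inversion do not exhaust the field. -/
theorem exists_map_ne_zero_map_inv_ne_zero [Finite K] (hτ : Function.Surjective τ)
    (hk : 3 ≤ Nat.card k) : ∃ z, τ z ≠ 0 ∧ τ z⁻¹ ≠ 0 := by
  by_contra! h
  have hu : (Set.univ : Set K) ⊆ (LinearMap.ker τ : Set K) ∪ (LinearMap.ker τ : Set K)⁻¹ := by
    intro x _
    by_cases hx : τ x = 0
    exacts [.inl hx, .inr (h x hx)]
  have h1 := (Set.ncard_le_ncard hu).trans (Set.ncard_union_le _ _)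
  rw [Set.ncard_inv, Set.ncard_univ, ← (card_fiber_mul hτ).2] at h1
  have h2 : (LinearMap.ker τ : Set K).ncard = Nat.card (LinearMap.ker τ) := rfl
  have h3 : 0 < Nat.card (LinearMap.ker τ) := Nat.card_pos
  rw [h2] at h1
  nlinarith

end Shear

/-- Over a quadratic extension `F` of a field `K` with a proper subfield `k`, two disjoint blocking
sets of trace type of the subplane over `K` form a saturating family. -/
theorem exists_isSaturating {k K F : Type*} [Field k] [Field K] [Field F] [Finite F] [Algebra k K]
    [Algebra K F] (hF : finrank K F = 2) (hK : 2 ≤ finrank k K) (hk : 3 ≤ Nat.card k) :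
    ∃ (τ : K →ₗ[k] k) (h : Bool × (K ⊕ {x : K // τ x = 1} ⊕ Unit) → F × F × F),
      IsSaturating F h id ∧ Nat.card {x : K // τ x = 1} * Nat.card k = Nat.card K := by
  have : Finite K := Finite.of_injective _ (algebraMap K F).injective
  obtain ⟨τ, hτ0, hτ⟩ := exists_dual_ne_zero_of_finrank_lt (K := k) (S := k ∙ (1 : K))
    (by rw [finrank_span_singleton one_ne_zero]; omega)
  have h₁ := hτ 1 (Submodule.mem_span_singleton_self 1)
  have hsurj : Function.Surjective τ := LinearMap.surjective hτ0
  obtain ⟨z, hz, hz'⟩ := exists_map_ne_zero_map_inv_ne_zero hsurj hk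
  obtain ⟨η, a, ha, hv⟩ := exists_forall_shear_mul_shear_ne h₁ hz hz'
  have hs (ε : k) (x : K) (hx : τ x = 0) : shear τ ε x = x := by simp [shear_apply, hx]
  refine ⟨τ, fun i : Bool × (K ⊕ {x : K // τ x = 1} ⊕ Unit) ↦
      baseChange F (blockingMap τ η a i.1 (representative τ i.2)),
    isSaturating_baseChange (k := k) hF (W := fun b ↦ LinearMap.range (blockingMap τ η a b))
      (h := fun i : Bool × (K ⊕ {x : K // τ x = 1} ⊕ Unit) ↦
        blockingMap τ η a i.1 (representative τ i.2)) ?_ ?_ ?_,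
    (card_fiber_mul hsurj).1⟩
  · intro b ℓ
    -- the linear set has larger dimension over `k` than the field `K`
    obtain ⟨p, hp, hp0⟩ := Submodule.exists_mem_ne_zero_of_ne_bot
      (LinearMap.ker_ne_bot_of_finrank_lt (f := ℓ.restrictScalars k ∘ₗ blockingMap τ η a b)
        (by rw [finrank_prod, finrank_self]; omega))
    refine ⟨_, ⟨p, rfl⟩, ?_, hp⟩
    rwa [Ne, map_eq_zero_iff _ (blockingMap_injective η a b)]
  · rintro _ ⟨p, rfl⟩ _ ⟨p', rfl⟩ hp hp'
    refine linearIndependent_blockingMap h₁ ha hv ?_ ?_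
    · rintro rfl; exact hp (map_zero _)
    · rintro rfl; exact hp' (map_zero _)
  · rintro b _ ⟨p, rfl⟩
    obtain ⟨i, c, h⟩ := exists_eq_smul_representative (τ := τ) (blockingMap τ η a b) (by
      intro x hx
      cases b <;> simp [blockingMap_true, blockingMap_false, hs _ _ hx, hs _ _ h₁, mul_comm]) p
    exact ⟨(b, i), c, h⟩

/-! ### Codes of covering radius two and their direct sums -/

/-- Shorter families are extended by zero vectors. -/
theorem HasSaturatingFamily.existsCode {F : Type*} [Field F] [Finite F] {n r k N : ℕ}
    (hs : HasSaturatingFamily F n r k) (hn : 0 < n) (hN : n ≤ N)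
    (hlt : N * Nat.card F < Nat.card F ^ r) : ExistsCode F N r 2 := by
  obtain ⟨V, _, _, _, h, κ, hr, hs⟩ := hs
  refine existsCode_two_of_family hr (fun i ↦ if hi : (i : ℕ) < n then h ⟨i, hi⟩ else 0) ?_ hlt
  intro u
  by_cases hu : u = 0
  · exact ⟨⟨0, hn.trans_le hN⟩, ⟨0, hn.trans_le hN⟩, 0, 0, by simp [hu]⟩
  · obtain ⟨i, j, -, c, d, -, -, rfl⟩ := hs u hu
    exact ⟨Fin.castLE hN i, Fin.castLE hN j, c, d, by simp⟩

theorem two_le_finrank_of_ne_top {K : Type*} [Field K] [Finite K] {k : Subfield K} (hk : k ≠ ⊤) :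
    2 ≤ finrank k K := by
  have h0 : 0 < finrank k K := finrank_pos
  by_contra! h
  have h1 : finrank k K = 1 := by omega
  refine hk (top_unique fun x _ ↦ ?_)
  obtain ⟨c, rfl⟩ := (finrank_eq_one_iff_of_nonzero' (1 : K) one_ne_zero).1 h1 x
  exact mul_mem c.2 (one_mem k)

/-- The natural number `⌊q ^ (t - 2)⌋`. -/
def floorPow (q t : ℕ) : ℕ := if t = 1 then 0 else q ^ (t - 2)

/-- The value of `fTerm` at `r = t R + R / 2`, as a natural number. -/
def extraLength (q t : ℕ) : ℕ := if t = 4 ∨ t = 6 then q ^ (t - 3) + q ^ (t - 4) else 0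

theorem floorPow_le {q t : ℕ} (hq : 0 < q) : floorPow q t ≤ q ^ (t - 1) := by
  unfold floorPow
  split_ifs
  · exact Nat.zero_le _
  · exact Nat.pow_le_pow_right hq (by omega)

theorem extraLength_le {q t : ℕ} (hq : 0 < q) : extraLength q t ≤ 2 * q ^ (t - 1) := by
  unfold extraLength
  split_ifs
  · have h1 : q ^ (t - 3) ≤ q ^ (t - 1) := Nat.pow_le_pow_right hq (by omega)
    have h2 : q ^ (t - 4) ≤ q ^ (t - 1) := Nat.pow_le_pow_right hq (by omega)
    omega
  · exact Nat.zero_le _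

/-- The codes of even covering radius obtained from a proper subfield `k` of the field `K` of order
`√q`, which has additive index `N` in `K`. -/
theorem existsCode_of_subfield {K F : Type*} [Field K] [Field F] [Finite F] [Algebra K F]
    (hF : finrank K F = 2) {k : Subfield K} (hk : k ≠ ⊤) (hk3 : 3 ≤ Nat.card k) {N M t : ℕ}
    (hN : N * Nat.card k = Nat.card K) (hNM : N + 1 ≤ M) (hM : 2 * M ≤ Nat.card K) (ht : 1 ≤ t)
    (s : ℕ) :
    ExistsCode F (s * (2 * (Nat.card K + M) * Nat.card F ^ (t - 1) + 2 * floorPow (Nat.card F) t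
      + extraLength (Nat.card F) t)) (s * (2 * t + 1)) (s * 2) := by
  have : Finite K := Finite.of_injective _ (algebraMap K F).injective
  have hd := two_le_finrank_of_ne_top hk
  obtain ⟨τ, h, hs, hcard⟩ := exists_isSaturating (F := F) hF hd hk3
  have hτN : Nat.card {x : K // τ x = 1} = N :=
    Nat.eq_of_mul_eq_mul_right (by omega) (hcard.trans hN.symm)
  have hn₀ : Nat.card (Bool × (K ⊕ {x : K // τ x = 1} ⊕ Unit)) = 2 * (Nat.card K + (N + 1)) := by
    simp [Nat.card_sum, hτN]
  have hkN : Nat.card k ≤ N := by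
    have h1 : Nat.card k ^ 2 ≤ Nat.card K := by
      rw [natCard_eq_pow_finrank (K := k) (V := K)]
      exact Nat.pow_le_pow_right (by omega) hd
    rw [← hN, sq] at h1
    exact Nat.le_of_mul_le_mul_right h1 (by omega)
  have hKN : 3 * N ≤ Nat.card K := by rw [← hN, mul_comm]; exact Nat.mul_le_mul_left _ hk3
  have hq : Nat.card F = Nat.card K ^ 2 := by
    have : FiniteDimensional K F := FiniteDimensional.of_finrank_pos (by omega)
    rw [natCard_eq_pow_finrank (K := K) (V := F), hF]
  have hfr : finrank F (F × F × F) = 3 := by simp [finrank_prod]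
  have hQ9 : 9 ≤ Nat.card K := by omega
  have hcl : 2 * (2 * (Nat.card K + (N + 1)) + 4) ≤ Nat.card F + 1 := by rw [hq]; nlinarith
  have hfam : ∃ c, HasSaturatingFamily F (2 * (Nat.card K + (N + 1)) * Nat.card F ^ (t - 1)
      + 2 * floorPow (Nat.card F) t) (2 * t + 1) c := by
    have h2 := hs.hasSaturatingFamily_lift (by omega) (by omega)
    rw [hn₀, hfr] at h2
    rcases ht.eq_or_lt with rfl | ht
    · exact ⟨_, hs.hasSaturatingFamily (by simp [floorPow, hn₀]) hfr le_rfl⟩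
    obtain ⟨u, rfl⟩ : ∃ u, t = u + 2 := ⟨t - 2, by omega⟩
    rcases Nat.eq_zero_or_pos u with rfl | hu
    · exact ⟨_, by simpa [floorPow] using h2⟩
    · have h3 := h2.iterate (by omega) hcl (by nlinarith) u hu
      refine ⟨Nat.card F ^ u + 1, ?_⟩
      have hlen : 2 * (Nat.card K + (N + 1)) * Nat.card F ^ (u + 2 - 1)
          + 2 * floorPow (Nat.card F) (u + 2)
          = (2 * (Nat.card K + (N + 1)) * Nat.card F + 2) * Nat.card F ^ u := by
        simp only [floorPow, Nat.add_sub_cancel, show u + 2 - 1 = u + 1 by omega,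
          if_neg (by omega : u + 2 ≠ 1)]
        ring
      rw [hlen, show 2 * (u + 2) + 1 = 3 + 2 + 2 * u by ring]
      exact h3
  obtain ⟨c, hfam⟩ := hfam
  generalize hQ : Nat.card K = Q at *
  generalize hqF : Nat.card F = q at *
  have hq0 : 0 < q := by rw [hq]; positivity
  have hy : 0 < q ^ (t - 1) := by positivity
  have hcode := hfam.existsCode
    (N := 2 * (Q + M) * q ^ (t - 1) + 2 * floorPow q t + extraLength q t)
    (by positivity) (by
      have : 2 * (Q + (N + 1)) * q ^ (t - 1) ≤ 2 * (Q + M) * q ^ (t - 1) := by gcongr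
      omega) (by
      rw [hqF, pow_succ]
      refine Nat.mul_lt_mul_of_pos_right ?_ hq0
      have h1 := floorPow_le (t := t) hq0
      have h2 := extraLength_le (t := t) hq0
      calc _ ≤ (2 * (Q + M) + 4) * q ^ (t - 1) := by linarith
        _ < q * q ^ (t - 1) := by
          refine Nat.mul_lt_mul_of_pos_right ?_ hy
          rw [hq]; nlinarith
        _ = q ^ t := by rw [← pow_succ', Nat.sub_add_cancel ht]
        _ ≤ q ^ (2 * t) := Nat.pow_le_pow_right hq0 (by omega))
  exact hcode.nsmul s

/-! ### The lengths as natural numbers -/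

section Lengths

variable {q Q s t : ℕ}

theorem exponent_eq (hs : 0 < s) (a : ℝ) :
    (((s * (2 * t + 1) : ℕ) : ℝ) - a * (s * 2 : ℕ)) / (s * 2 : ℕ) = t + 1 / 2 - a := by
  have : (s : ℝ) ≠ 0 := by positivity
  push_cast
  field_simp

theorem rpow_eq_pow (hq : q = Q ^ 2) {x : ℝ} {m : ℕ} (hx : 2 * x = m) :
    (q : ℝ) ^ x = (Q : ℝ) ^ m := by
  rw [hq, Nat.cast_pow, ← Real.rpow_natCast_mul (by positivity), Nat.cast_ofNat, hx,
    Real.rpow_natCast]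

theorem rpow_eq (hs : 0 < s) (ht : 1 ≤ t) (hq : q = Q ^ 2) :
    (q : ℝ) ^ ((((s * (2 * t + 1) : ℕ) : ℝ) - (s * 2 : ℕ)) / (s * 2 : ℕ))
      = Q * (q : ℝ) ^ (t - 1) := by
  have h := exponent_eq (t := t) hs 1
  rw [one_mul] at h
  rw [h, rpow_eq_pow hq (m := 2 * (t - 1) + 1) (by push_cast [Nat.cast_sub ht]; ring), hq]
  push_cast
  ring

theorem floorTerm_eq (hs : 0 < s) (ht : 1 ≤ t) (hq : q = Q ^ 2) (hQ : 1 < Q) :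
    floorTerm q (s * (2 * t + 1)) (s * 2) = floorPow q t := by
  unfold floorTerm floorPow
  rw [exponent_eq hs 2]
  split_ifs with h
  · subst h
    have hq1 : (1 : ℝ) < q := by rw [hq]; exact_mod_cast Nat.one_lt_pow two_ne_zero hQ
    have : ⌊(q : ℝ) ^ (((1 : ℕ) : ℝ) + 1 / 2 - 2 - 1 / 2)⌋ = 0 := by
      rw [Int.floor_eq_zero_iff]
      refine ⟨by positivity, Real.rpow_lt_one_of_one_lt_of_neg hq1 (by norm_num)⟩
    rw [this]
    simp
  · rw [rpow_eq_pow hq (m := 2 * (t - 2)) (by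
      push_cast [Nat.cast_sub (by omega : 2 ≤ t)]; ring), hq, ← pow_mul]
    rw [← Nat.cast_pow, Int.floor_natCast]
    simp

theorem fTerm_eq (hs : 0 < s) (hq : q = Q ^ 2) :
    fTerm q (s * (2 * t + 1)) (s * 2) = extraLength q t := by
  unfold fTerm extraLength
  have hiff : 2 * (s * (2 * t + 1)) = 9 * (s * 2) ∨ 2 * (s * (2 * t + 1)) = 13 * (s * 2) ↔
      t = 4 ∨ t = 6 := by
    rw [show 2 * (s * (2 * t + 1)) = s * (4 * t + 2) by ring, show 9 * (s * 2) = s * 18 by ring,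
      show 13 * (s * 2) = s * 26 by ring, Nat.mul_right_inj hs.ne', Nat.mul_right_inj hs.ne']
    omega
  rw [exponent_eq hs 3, exponent_eq hs 4]
  by_cases h : t = 4 ∨ t = 6
  · rw [if_pos (hiff.2 h), if_pos h, rpow_eq_pow hq (m := 2 * (t - 3)) (by
      push_cast [Nat.cast_sub (by omega : 3 ≤ t)]; ring),
      rpow_eq_pow hq (m := 2 * (t - 4)) (by
      push_cast [Nat.cast_sub (by omega : 4 ≤ t)]; ring), hq]
    push_cast
    ring
  · rw [if_neg (mt hiff.1 h), if_neg h, Nat.cast_zero]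

theorem sqrt_natCast_sq (hq : q = Q ^ 2) : √(q : ℝ) = Q := by
  rw [hq, Nat.cast_pow, Real.sqrt_sq (by positivity)]

theorem subfieldLength_eq (hs : 0 < s) (ht : 1 ≤ t) (hq : q = Q ^ 2) (hQ : 1 < Q) {φ M : ℕ}
    (hφ : 2 ≤ φ) (hM : (φ - 1) * M = Q - 1) :
    subfieldLength q φ (s * (2 * t + 1)) (s * 2) =
      (s * (2 * (Q + M) * q ^ (t - 1) + 2 * floorPow q t + extraLength q t) : ℕ) := by
  rw [subfieldLength, rpow_eq hs ht hq, floorTerm_eq hs ht hq hQ, fTerm_eq hs hq,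
    sqrt_natCast_sq hq]
  have hφ' : (φ : ℝ) - 1 ≠ 0 := by
    have : (2 : ℝ) ≤ φ := by exact_mod_cast hφ
    linarith
  have hQ0 : (Q : ℝ) ≠ 0 := by positivity
  have hM' : (Q : ℝ) - 1 = (φ - 1) * M := by
    have := congrArg (Nat.cast (R := ℝ)) hM
    push_cast [Nat.cast_sub (by omega : 1 ≤ φ), Nat.cast_sub hQ.le] at this
    linarith
  rw [hM', mul_comm (Q : ℝ) (φ - 1), mul_div_mul_left _ _ hφ']
  push_cast
  field_simp

theorem charLength_eq (hs : 0 < s) (ht : 1 ≤ t) (hq : q = Q ^ 2) (hQ : 1 < Q) {p N : ℕ}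
    (hN : N * p = Q) :
    charLength q p (s * (2 * t + 1)) (s * 2) =
      (s * (2 * (Q + (N + 1)) * q ^ (t - 1) + 2 * floorPow q t + extraLength q t) : ℕ) := by
  rw [charLength, rpow_eq hs ht hq, floorTerm_eq hs ht hq hQ, fTerm_eq hs hq, sqrt_natCast_sq hq]
  have hp0 : (p : ℝ) ≠ 0 := by
    rintro h
    rw [Nat.cast_eq_zero] at h
    subst h
    omega
  have hQ0 : (Q : ℝ) ≠ 0 := by positivity
  have hN' : (Q : ℝ) = N * p := by exact_mod_cast hN.symm
  have : (1 + 1 / (p : ℝ) + 1 / Q) * (Q * (q : ℝ) ^ (t - 1)) = (Q + N + 1) * (q : ℝ) ^ (t - 1) := by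
    have h1 : (1 + 1 / (p : ℝ) + 1 / Q) * Q = Q + N + 1 := by
      have : 1 / (p : ℝ) * Q = N := by rw [hN']; field_simp
      rw [add_mul, add_mul, this, one_div_mul_cancel hQ0, one_mul]
    rw [← mul_assoc, h1]
  rw [mul_assoc, this]
  push_cast
  ring

/-- Both new lengths are below the known bound for squares, as `M` is less than about `Q / 2`. -/
theorem length_lt_knownSquareBound (hs : 0 < s) (ht : 1 ≤ t) (hq : q = Q ^ 2) (hQ : 1 < Q) {M : ℕ}
    (hM : 2 * M + 4 < Q) :
    ((s * (2 * (Q + M) * q ^ (t - 1) + 2 * floorPow q t + extraLength q t) : ℕ) : ℝ) <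
      knownSquareBound q (s * (2 * t + 1)) (s * 2) := by
  rw [knownSquareBound, rpow_eq hs ht hq, floorTerm_eq hs ht hq hQ, sqrt_natCast_sq hq]
  have hQ0 : (Q : ℝ) ≠ 0 := by positivity
  have hq0 : 0 < q := by rw [hq]; positivity
  have h1 : (floorPow q t : ℝ) ≤ (q : ℝ) ^ (t - 1) := by exact_mod_cast floorPow_le hq0
  have h2 : (extraLength q t : ℝ) ≤ 2 * (q : ℝ) ^ (t - 1) := by exact_mod_cast extraLength_le hq0
  have h3 : (2 * M + 4 : ℝ) < Q := by exact_mod_cast hM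
  have hy : (0 : ℝ) < (q : ℝ) ^ (t - 1) := by positivity
  have hs' : (0 : ℝ) < s := by exact_mod_cast hs
  have h4 := mul_lt_mul_of_pos_right h3 hy
  have hrhs : (((s * 2 : ℕ) : ℝ) / 2) * (3 - 1 / (Q : ℝ)) * (Q * (q : ℝ) ^ (t - 1))
      + ((s * 2 : ℕ) : ℝ) / 2 * floorPow q t
      = s * ((3 * Q - 1) * (q : ℝ) ^ (t - 1) + floorPow q t) := by
    push_cast
    field_simp
  rw [hrhs]
  push_cast
  refine mul_lt_mul_of_pos_left ?_ hs'
  linarith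

theorem charLength_eq_knownSixthBound_sub {p : ℕ} (hp : 0 < p) (hq : q = p ^ 6) (hs : 0 < s)
    (h4 : t ≠ 4) (h6 : t ≠ 6) :
    charLength q p (s * (2 * t + 1)) (s * 2) = knownSixthBound q (s * (2 * t + 1)) (s * 2)
      - (s * 2 : ℕ) * (q : ℝ) ^
        ((((s * (2 * t + 1) : ℕ) : ℝ) - (s * 2 : ℕ)) / (s * 2 : ℕ) - 1 / 3) := by
  have hq3 : q = (p ^ 3) ^ 2 := by rw [hq]; ring
  have hqpos : (0 : ℝ) < q := by rw [hq]; positivity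
  have h16 : (q : ℝ) ^ (1 / 6 : ℝ) = p := by
    rw [hq, Nat.cast_pow, ← Real.rpow_natCast_mul (by positivity)]
    norm_num
  have h13 : (q : ℝ) ^ (1 / 3 : ℝ) = (p : ℝ) ^ 2 := by
    rw [hq, Nat.cast_pow, ← Real.rpow_natCast_mul (by positivity), ← Real.rpow_natCast]
    norm_num
  rw [charLength, knownSixthBound, fTerm_eq hs hq3, extraLength, if_neg (by omega), Nat.cast_zero,
    Real.rpow_sub hqpos, h16, h13]
  ring

end Lengths

/-! ### Embedding the field of order `√q` -/

theorem exists_algebra_finrank_eq_two (p : ℕ) [Fact p.Prime] {h : ℕ} (hh : h ≠ 0) (F : Type*)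
    [Field F] [Finite F] (hF : Nat.card F = p ^ (2 * h)) :
    ∃ _ : Algebra (GaloisField p h) F, finrank (GaloisField p h) F = 2 := by
  have hp : p.Prime := Fact.out
  have : CharP F p := by
    cases nonempty_fintype F
    exact charP_of_card_eq_prime_pow (by rw [← Nat.card_eq_fintype_card, hF])
  let _ : Algebra (ZMod p) F := ZMod.algebra F p
  have hfr : finrank (ZMod p) F = 2 * h := by
    have := natCard_eq_pow_finrank (K := ZMod p) (V := F)
    rw [hF, Nat.card_zmod] at this
    exact (Nat.pow_right_injective hp.two_le this).symm
  obtain ⟨f⟩ := FiniteField.nonempty_algHom_of_finrank_dvd (F := ZMod p) (K := GaloisField p h)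
    (L := F) (by rw [GaloisField.finrank p hh, hfr]; exact dvd_mul_left _ _)
  let _ : Algebra (GaloisField p h) F := f.toRingHom.toAlgebra
  refine ⟨inferInstance, ?_⟩
  have := natCard_eq_pow_finrank (K := GaloisField p h) (V := F)
  rw [hF, GaloisField.card p h hh, ← pow_mul] at this
  have := Nat.pow_right_injective hp.two_le this
  exact (Nat.eq_of_mul_eq_mul_left (Nat.pos_of_ne_zero hh) (by linarith)).symm

/-- The order of the largest proper subfield is attained, and the prime field bounds it below. -/
theorem exists_subfield_card_eq_largestProperSubfieldOrder (p : ℕ) [Fact p.Prime] {h : ℕ}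
    (hh : 2 ≤ h) :
    (⊥ : Subfield (GaloisField p h)) ≠ ⊤ ∧ p ≤ largestProperSubfieldOrder (GaloisField p h) ∧
      ∃ k : Subfield (GaloisField p h), k ≠ ⊤ ∧
        Nat.card k = largestProperSubfieldOrder (GaloisField p h) := by
  have hp : p.Prime := Fact.out
  have hbot : (⊥ : Subfield (GaloisField p h)) ≠ ⊤ := by
    intro hbt
    have h1 := Subfield.card_bot (GaloisField p h) p
    rw [hbt, Nat.card_congr Subfield.topEquiv.toEquiv, GaloisField.card p h (by omega)] at h1
    exact (by omega : h ≠ 1) (Nat.pow_right_injective hp.two_le (by simpa using h1))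
  have hmem : p ∈ {m : ℕ | ∃ K : Subfield (GaloisField p h), K ≠ ⊤ ∧ Nat.card K = m} :=
    ⟨⊥, hbot, Subfield.card_bot _ p⟩
  have hbdd : BddAbove {m : ℕ | ∃ K : Subfield (GaloisField p h), K ≠ ⊤ ∧ Nat.card K = m} :=
    ⟨Nat.card (GaloisField p h), by
      rintro _ ⟨K, -, rfl⟩
      exact Nat.card_le_card_of_injective _ Subtype.val_injective⟩
  exact ⟨hbot, le_csSup hbdd hmem, Nat.sSup_mem ⟨p, hmem⟩ hbdd⟩

/-- For a proper subfield of order `φ` and additive index `N` in a field of order `Q`, the number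
`M = (Q - 1) / (φ - 1)` is an integer greater than `N`. -/
theorem exists_mul_eq_card_sub_one {K : Type*} [Field K] [Finite K] {k : Subfield K} (hk : k ≠ ⊤) :
    ∃ N M, N * Nat.card k = Nat.card K ∧ (Nat.card k - 1) * M = Nat.card K - 1 ∧ N + 1 ≤ M ∧
      Nat.card k ≤ N := by
  have hd := two_le_finrank_of_ne_top hk
  have hcard := natCard_eq_pow_finrank (K := k) (V := K)
  have h1 : 1 < Nat.card k := Finite.one_lt_card
  obtain ⟨d, hd'⟩ := Nat.exists_eq_add_of_le' (by omega : 1 ≤ finrank k K)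
  obtain ⟨M, hM⟩ : Nat.card k - 1 ∣ Nat.card K - 1 := by
    rw [hcard]
    simpa using Nat.sub_dvd_pow_sub_pow (Nat.card k) 1 (finrank k K)
  have hN : Nat.card k ^ d * Nat.card k = Nat.card K := by rw [← pow_succ, hcard, hd']
  have hle : Nat.card k ≤ Nat.card k ^ d := Nat.le_self_pow (by omega) _
  refine ⟨Nat.card k ^ d, M, hN, hM.symm, ?_, hle⟩
  generalize Nat.card k ^ d = N at *
  generalize Nat.card K = Q at *
  generalize Nat.card k = φ at *
  obtain ⟨ψ, rfl⟩ := Nat.exists_eq_add_of_le' h1.le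
  subst hN
  refine Nat.le_of_mul_le_mul_left (?_ : ψ * (N + 1) ≤ ψ * M) (by omega)
  rw [Nat.add_sub_cancel] at hM
  rw [← hM]
  have : N * (ψ + 1) = ψ * N + N := by ring
  have : ψ * (N + 1) = ψ * N + ψ := by ring
  omega

end CoveringCode

theorem mainTheorem11 (p : ℕ) [Fact p.Prime] (h : ℕ) (hh : 2 ≤ h)
    (q : ℕ) (hq : q = p ^ (2 * h))
    (R : ℕ) (hR : 2 ≤ R) (hReven : Even R)
    (t : ℕ) (ht : 1 ≤ t) (r : ℕ) (hr : r = t * R + R / 2)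
    (φ : ℕ) (hφ : φ = CoveringCode.largestProperSubfieldOrder (GaloisField p h))
    (F : Type*) [Field F] [Finite F] (hF : Nat.card F = q) :
    (3 ≤ p →
      (∃ n : ℕ, (n : ℝ) = CoveringCode.subfieldLength q φ r R ∧ CoveringCode.ExistsCode F n r R) ∧
      (CoveringCode.lengthFunction F r R : ℝ) ≤ CoveringCode.subfieldLength q φ r R) ∧
    (7 ≤ p →
      (∃ n : ℕ, (n : ℝ) = CoveringCode.charLength q p r R ∧ CoveringCode.ExistsCode F n r R) ∧
      (CoveringCode.lengthFunction F r R : ℝ) ≤ CoveringCode.charLength q p r R) ∧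
    -- comparison of the new bounds with the previously known ones, for odd `h ≥ 3`
    (Odd h →
      (3 ≤ p → φ ≠ 3 →
        CoveringCode.subfieldLength q φ r R < CoveringCode.knownSquareBound q r R) ∧
      (7 ≤ p →
        CoveringCode.charLength q p r R < CoveringCode.knownSquareBound q r R) ∧
      (7 ≤ p → h = 3 → t ≠ 4 → t ≠ 6 →
        CoveringCode.charLength q p r R
          = CoveringCode.knownSixthBound q r R
            - R * (q : ℝ) ^ (((r : ℝ) - R) / R - 1 / 3))) := by
  open CoveringCode in
  have hp : p.Prime := Fact.out
  obtain ⟨s, rfl⟩ := hReven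
  obtain rfl : r = s * (2 * t + 1) := by
    rw [hr, show (s + s) / 2 = s by omega]; ring
  rw [← mul_two] at hR ⊢
  have hs : 0 < s := by omega
  obtain ⟨hbot, hpφ, k, hk, hkφ⟩ := exists_subfield_card_eq_largestProperSubfieldOrder p hh
  rw [← hφ] at hkφ hpφ
  obtain ⟨_, hfr⟩ := exists_algebra_finrank_eq_two p (by omega) F (hF.trans hq)
  have hQ : Nat.card (GaloisField p h) = p ^ h := GaloisField.card p h (by omega)
  obtain ⟨N, M, hN, hM, hNM, hkN⟩ := exists_mul_eq_card_sub_one hk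
  obtain ⟨N', -, hN', -, -, hkN'⟩ := exists_mul_eq_card_sub_one hbot
  rw [hkφ] at hN hM hkN
  rw [Subfield.card_bot (GaloisField p h) p] at hN' hkN'
  have hcode {k : Subfield (GaloisField p h)} {N M : ℕ} := existsCode_of_subfield (F := F) hfr
    (k := k) (N := N) (M := M) (ht := ht) (s := s)
  rw [hF, hQ] at hcode
  rw [hQ] at hN hM hN'
  have hq2 : q = (p ^ h) ^ 2 := by rw [hq, ← pow_mul, mul_comm]
  generalize p ^ h = Q at *
  have hp2 := hp.two_le
  have hQ1 : 1 < Q := by nlinarith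
  have hA := subfieldLength_eq hs ht hq2 hQ1 (by omega) hM
  have hB := charLength_eq hs ht hq2 hQ1 hN'
  rw [hA, hB]
  have hle {n r R : ℕ} (hn : ExistsCode F n r R) : (lengthFunction F r R : ℝ) ≤ n := by
    exact_mod_cast Nat.sInf_le hn
  refine ⟨fun hp3 ↦ ?_, fun hp7 ↦ ?_, fun _ ↦ ⟨fun hp3 hφ3 ↦ ?_, fun hp7 ↦ ?_,
    fun hp7 h3 h4 h6 ↦ ?_⟩⟩
  · have h2M : 2 * M ≤ (φ - 1) * M := Nat.mul_le_mul_right _ (by omega)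
    have := hcode hk (by omega) (by rwa [hkφ]) hNM (by omega)
    exact ⟨⟨_, rfl, this⟩, hle this⟩
  · have h7 : N' * 7 ≤ N' * p := Nat.mul_le_mul_left _ hp7
    have hb := Subfield.card_bot (GaloisField p h) p
    have := hcode hbot (by omega) (by rwa [hb]) le_rfl (by omega)
    exact ⟨⟨_, rfl, this⟩, hle this⟩
  · refine length_lt_knownSquareBound hs ht hq2 hQ1 ?_
    have h3M : 3 * M ≤ (φ - 1) * M := Nat.mul_le_mul_right _ (by omega)
    have : 4 * 4 ≤ N * φ := Nat.mul_le_mul (by omega) (by omega)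
    omega
  · refine length_lt_knownSquareBound hs ht hq2 hQ1 ?_
    have h7 : N' * 7 ≤ N' * p := Nat.mul_le_mul_left _ hp7
    omega
  · rw [← hB]
    exact charLength_eq_knownSixthBound_sub hp.pos (by rw [hq, h3]) hs h4 h6
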